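/- **Theorem (super-Narayana polynomials).** Let $h_n$ be the complete homogeneous symmetric functions and $p_k$ the power sums, and let $g_n=\frac{1}{n+1}h_n((n+1)X)$, where $h_n((n+1)X)$ is the symmetric function obtained by writing $h_n$ as a polynomial in the $p_k$ with rational coefficients and replacing every $p_k$ by $(n+1)p_k$. Let $g_n\!\left(\frac{1-x}{1-q}\right)$ be the image of $g_n$ under the character $p_k\mapsto\frac{1-x^k}{1-q^k}$ $(k\ge 1)$, let $(q)_n=\prod_{k=1}^n(1-q^k)$, and put $$P_n(t,q)=(q)_n\,g_n\!\left(\frac{1-x}{1-q}\right)\Big|_{x=-t}.$$ A parking function of length $n$ is a rearrangement $\mathbf a=a_1\cdots a_n$ of a nondecreasing word $\pi_1\cdots\pi_n$ of positive integers with $\pi_i\le i$ for all $i$. A signed parking function of length $n$ is a pair $(\mathbf a,\varepsilon)$ with $\mathbf a$ a parking function of length $n$ and $\varepsilon\in\{\pm1\}^n$. Say that positions $i<j$ are out of order if $\varepsilon_ia_i>\varepsilon_ja_j$, or if $\varepsilon_ia_i=\varepsilon_ja_j$ and the common sign is $-1$. A signed inversion is a pair of positions $i<j$ that are out of order; a signed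 descent is an index $i$ with $1\le i\le n-1$ such that $i,i+1$ are out of order; the signed major index is the sum of the signed descents. The signed parking function is called nondecreasing if $\varepsilon_1a_1\le\cdots\le\varepsilon_na_n$ and no negative letter is repeated (that is, $\varepsilon_ia_i=\varepsilon_ja_j$ with $i<j$ forces the common sign to be $+1$). Then, for every $n\ge 0$, $P_n(t,q)$ is a polynomial $\sum_{i,j}a_n(i,j)\,t^iq^j$ in $t$ and $q$, and for all $i,j\ge0$ the coefficient $a_n(i,j)$ is equal to the number of signed parking functions of length $n$ with $i$ minus signs and $j$ signed inversions, and also to the number of signed parking functions of length $n$ with $i$ minus signs and signed major index $j$. In particular, for every $k\ge0$, the coefficient of $t^k$ in $P_n(t,0)$ is the number of nondecreasing signed parking functions of length $n$ with $k$ minus signs. -/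

import Mathlib

namespace SuperNarayana

open scoped Polynomial

/-! ### Symmetric functions and virtual alphabets -/

/-- The ring of symmetric functions with rational coefficients, presented as the free commutative
`ℚ`-algebra on the power sums `p₁, p₂, …`. -/
abbrev SymFun : Type := MvPolynomial ℕ+ ℚ

/-- The power sum `p_k`. -/
noncomputable def powerSum (k : ℕ+) : SymFun := MvPolynomial.X k

/-- The complete homogeneous symmetric function `h_n`, expanded on power sums by
`h₀ = 1` and `n h_n = ∑_{k=1}^n p_k h_{n-k}`. See `realize_completeHom`: in every finite alphabet
this is the sum of all monomials of degree `n`. -/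
noncomputable def completeHom : ℕ → SymFun
  | 0 => 1
  | n + 1 => ((n : ℚ) + 1)⁻¹ •
      ∑ k : Fin (n + 1), powerSum (Nat.succPNat k) * completeHom (n - k)

/-- A virtual alphabet with values in `R` is given by the values `A k = p_k(A)` of the power sums;
`evalAt A f` is the value `f(A)` of the symmetric function `f`, in λ-ring notation. -/
noncomputable def evalAt {R : Type*} [CommRing R] [Algebra ℚ R] (A : ℕ+ → R) : SymFun →ₐ[ℚ] R :=
  MvPolynomial.aeval A

/-- The symmetric function `g_n(X) = h_n((n+1)X) / (n+1)`, where `p_k((n+1)X) = (n+1) p_k(X)`. -/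
noncomputable def lagrange (n : ℕ) : SymFun :=
  ((n : ℚ) + 1)⁻¹ • evalAt (fun k : ℕ+ => ((n : ℚ) + 1) • powerSum k) (completeHom n)

/-! ### Agreement of `completeHom` with complete homogeneous symmetric polynomials -/

section Realization

variable (σ : Type*) [Fintype σ] [DecidableEq σ]

theorem sum_count_succ (i : σ) (n : ℕ) :
    (∑ s : Sym σ (n + 1), (((s : Multiset σ).count i : ℕ) : MvPolynomial σ ℚ) *
        ((s : Multiset σ).map MvPolynomial.X).prod) =
      MvPolynomial.X i * (MvPolynomial.hsymm σ ℚ n +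
        ∑ s : Sym σ n, (((s : Multiset σ).count i : ℕ) : MvPolynomial σ ℚ) *
          ((s : Multiset σ).map MvPolynomial.X).prod) := by
  rw [MvPolynomial.hsymm, ← Finset.sum_add_distrib, Finset.mul_sum]
  symm
  refine Finset.sum_of_injOn (fun s => i ::ₛ s) ?_ ?_ ?_ ?_
  · intro s _ t _ h
    exact Sym.cons_inj_right i s t |>.1 h
  · intro s _
    simp
  · intro s _ hs
    have : i ∉ (s : Multiset σ) := by
      intro hi
      apply hs
      obtain ⟨t, ht⟩ := Sym.exists_cons_of_mem (s := s) (a := i) hi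
      exact ⟨t, by simp, ht.symm⟩
    rw [Multiset.count_eq_zero_of_notMem this]
    simp
  · intro s _
    simp only [Sym.coe_cons, Multiset.count_cons_self, Multiset.map_cons, Multiset.prod_cons]
    have hs : (s.val.map MvPolynomial.X).prod =
        ((s : Multiset σ).map (MvPolynomial.X (R := ℚ))).prod := rfl
    rw [hs]
    push_cast
    ring

theorem sum_count (i : σ) (n : ℕ) :
    (∑ s : Sym σ n, (((s : Multiset σ).count i : ℕ) : MvPolynomial σ ℚ) *
        ((s : Multiset σ).map MvPolynomial.X).prod) =
      ∑ k : Fin n, MvPolynomial.X i ^ ((k : ℕ) + 1) * MvPolynomial.hsymm σ ℚ (n - 1 - k) := by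
  induction n with
  | zero =>
    simp only [Finset.univ_eq_empty, Finset.sum_empty]
    refine Finset.sum_eq_zero fun s _ => ?_
    rw [Sym.eq_nil_of_card_zero s]
    simp
  | succ n ih =>
    rw [sum_count_succ, ih, Fin.sum_univ_succ, mul_add, Finset.mul_sum]
    congr 1
    · simp
    · refine Finset.sum_congr rfl fun k _ => ?_
      have : n + 1 - 1 - (k.succ : ℕ) = n - 1 - k := by simp; omega
      rw [this, Fin.val_succ]
      ring

/-- Newton's identity for the complete homogeneous symmetric polynomials. -/
theorem hsymm_newton (n : ℕ) :
    ((n + 1 : ℕ) : MvPolynomial σ ℚ) * MvPolynomial.hsymm σ ℚ (n + 1) =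
      ∑ k : Fin (n + 1), MvPolynomial.psum σ ℚ (k + 1) * MvPolynomial.hsymm σ ℚ (n - k) := by
  have h1 : ((n + 1 : ℕ) : MvPolynomial σ ℚ) * MvPolynomial.hsymm σ ℚ (n + 1) =
      ∑ i : σ, ∑ s : Sym σ (n + 1), (((s : Multiset σ).count i : ℕ) : MvPolynomial σ ℚ) *
        ((s : Multiset σ).map MvPolynomial.X).prod := by
    rw [Finset.sum_comm, MvPolynomial.hsymm, Finset.mul_sum]
    refine Finset.sum_congr rfl fun s _ => ?_
    rw [← Finset.sum_mul, ← Nat.cast_sum,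
      Multiset.sum_count_eq_card (s := Finset.univ) (fun a _ => Finset.mem_univ a)]
    simp
  rw [h1]
  simp only [sum_count, MvPolynomial.psum, Finset.sum_mul]
  rw [Finset.sum_comm]
  simp

/-- In any finite alphabet `(x_i)`, the value of `completeHom n` is the complete homogeneous
symmetric polynomial of degree `n`. -/
theorem realize_completeHom (n : ℕ) :
    evalAt (fun k : ℕ+ => MvPolynomial.psum σ ℚ k) (completeHom n) =
      MvPolynomial.hsymm σ ℚ n := by
  induction n using Nat.strong_induction_on with
  | _ n ih =>
    cases n with
    | zero => simp [completeHom]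
    | succ n =>
      rw [completeHom, map_smul, map_sum]
      have : ∀ k : Fin (n + 1),
          evalAt (fun k : ℕ+ => MvPolynomial.psum σ ℚ k)
            (powerSum (Nat.succPNat k) * completeHom (n - k)) =
          MvPolynomial.psum σ ℚ (k + 1) * MvPolynomial.hsymm σ ℚ (n - k) := by
        intro k
        rw [map_mul, ih (n - k) (by omega)]
        simp [evalAt, powerSum]
      rw [Finset.sum_congr rfl fun k _ => this k, ← hsymm_newton, ← nsmul_eq_mul,
        ← Nat.cast_smul_eq_nsmul ℚ, smul_smul]
      push_cast
      rw [inv_mul_cancel₀ (by positivity), one_smul]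

end Realization

/-! ### The super-Narayana polynomials -/

/-- The variable `q` of the field `ℚ(q)`. -/
noncomputable abbrev q : RatFunc ℚ := RatFunc.X

/-- The virtual alphabet `(1 - x) / (1 - q)` with values in `ℚ(q)[x]`:
`p_k((1 - x) / (1 - q)) = (1 - x^k) / (1 - q^k)`. -/
noncomputable def superAlphabet (k : ℕ+) : (RatFunc ℚ)[X] :=
  Polynomial.C (1 - q ^ (k : ℕ))⁻¹ * (1 - Polynomial.X ^ (k : ℕ))

/-- `(q)_n = (1 - q)(1 - q²)⋯(1 - qⁿ)`. -/
noncomputable def qPochhammer (n : ℕ) : RatFunc ℚ :=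
  ∏ k ∈ Finset.Icc 1 n, (1 - q ^ k)

/-- `P_n(t, q) = (q)_n g_n((1 - x) / (1 - q))` at `x = -t`, as an element of `ℚ(q)[t]`. -/
noncomputable def superNarayana (n : ℕ) : (RatFunc ℚ)[X] :=
  Polynomial.C (qPochhammer n) *
    (evalAt superAlphabet (lagrange n)).comp (-Polynomial.X)

/-! ### Signed parking functions -/

/-- A nondecreasing parking function: a nondecreasing word `a₁ ⋯ a_n` of positive integers with
`a_i ≤ i` (position `i` is `i - 1 : Fin n`). -/
def IsNondecreasingParking {n : ℕ} (a : Fin n → ℕ) : Prop :=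
  Monotone a ∧ ∀ i : Fin n, 1 ≤ a i ∧ a i ≤ (i : ℕ) + 1

/-- A parking function: a rearrangement of a nondecreasing parking function. -/
def IsParking {n : ℕ} (a : Fin n → ℕ) : Prop :=
  ∃ τ : Equiv.Perm (Fin n), IsNondecreasingParking (a ∘ τ)

/-- A signed parking function `(a, ε)` of length `n`. -/
@[ext]
structure SignedParking (n : ℕ) where
  /-- the underlying parking function -/
  word : Fin n → ℕ
  /-- the word of signs -/
  sign : Fin n → ℤˣ
  isParking : IsParking word

namespace SignedParking

variable {n : ℕ}

instance : Finite (SignedParking n) := by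
  have hle : ∀ (w : SignedParking n) (i : Fin n), w.word i < n + 1 := by
    intro w i
    obtain ⟨τ, -, h⟩ := w.isParking
    have := (h (τ.symm i)).2
    simp only [Function.comp_apply, Equiv.apply_symm_apply] at this
    have := (τ.symm i).isLt
    omega
  refine Finite.of_injective
    (fun w : SignedParking n => ((fun i => (⟨w.word i, hle w i⟩ : Fin (n + 1))), w.sign)) ?_
  intro w v h
  simp only [Prod.mk.injEq, funext_iff, Fin.mk.injEq] at h
  exact SignedParking.ext (funext h.1) (funext h.2)

/-- The signed letter `ε_i a_i`. -/
def letter (w : SignedParking n) (i : Fin n) : ℤ := (w.sign i : ℤ) * (w.word i : ℤ)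

/-- The number of minus signs. -/
noncomputable def minusCount (w : SignedParking n) : ℕ := Nat.card {i : Fin n // w.sign i = -1}

/-- The letters at positions `i` and `j` are out of order: `ε_i a_i > ε_j a_j`, or
`ε_i a_i = ε_j a_j` and the common sign is `-1`. -/
def OutOfOrder (w : SignedParking n) (i j : Fin n) : Prop :=
  w.letter j < w.letter i ∨ (w.letter i = w.letter j ∧ w.sign i = -1)

/-- The number of signed inversions, i.e. of pairs of positions `i < j` out of order. -/
noncomputable def sinv (w : SignedParking n) : ℕ :=
  Nat.card {ij : Fin n × Fin n // ij.1 < ij.2 ∧ w.OutOfOrder ij.1 ij.2}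

/-- `d` (with `1 ≤ d ≤ n - 1`) is a signed descent: the letters at the `d`-th and `(d+1)`-st
positions are out of order. -/
def IsSignedDescent (w : SignedParking n) (d : ℕ) : Prop :=
  ∃ i j : Fin n, (i : ℕ) + 1 = d ∧ (j : ℕ) = d ∧ w.OutOfOrder i j

open Classical in
/-- The signed major index: the sum of the signed descents. -/
noncomputable def smaj (w : SignedParking n) : ℕ :=
  ∑ d ∈ Finset.Icc 1 (n - 1) with w.IsSignedDescent d, d

/-- A nondecreasing signed parking function: the signed letters are weakly increasing, and a
negative letter is not repeated (two equal negative letters count as out of order). -/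
def IsNondecreasing (w : SignedParking n) : Prop :=
  Monotone w.letter ∧ ∀ i j : Fin n, i < j → w.letter i = w.letter j → 0 < w.letter i

end SignedParking

end SuperNarayana

/-! Let K(z) be the generating series of the h_n in a virtual alphabet. Multiplying all power sums
by n+1 raises K to the power n+1, so g_n takes the value [z^n] K^(n+1) / (n+1) (`evalAt_lagrange`).
For (1-x)/(1-q) at x = -t, K is the product of ∑ z^n/(q)_n and ∑ q^(n choose 2) (tz)^n/(q)_n: the
first factor accounts for positive letters, the second for negative ones.

Expanding K^(n+1) gives a sum over weak compositions m of n into n+1 parts of ∏ [z^(m_i)] K. Each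
summand is invariant under rotation of m, and exactly one of the n+1 rotations is the content of a
parking function (`existsUnique_rotation`). Restricting to parking contents therefore absorbs the
factor 1/(n+1).

For fixed m, (q)_n ∏ [z^(m_i)] K is a sum, over all ways of splitting each m_i between i+1 and
-(i+1), of q-multinomial coefficients times q^(r choose 2) for each negative letter occurring r
times. MacMahon's theorem, extended to odd letters, identifies each term with the generating
function of words of that content, by inversions (`sum_pow_inversions`) or by major index
(`sum_pow_majorIndex`). Both follow by removing the last letter and telescoping. At q = 0 only the
words without inversions survive. -/

namespace SuperNarayana

open scoped Polynomial

/-! ### Words over a totally ordered alphabet of even and odd letters -/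

section Words

variable {α : Type*}

/-- The number of pairs of positions `i < j` of the word `w` whose letters are related by `r`. -/
def inversions (r : α → α → Prop) [DecidableRel r] {n : ℕ} (w : Fin n → α) : ℕ :=
  ∑ i, ∑ j, if i < j ∧ r (w i) (w j) then 1 else 0

/-- The sum of the positions `d` such that the `d`-th and `(d+1)`-st letters are related by `r`. -/
def majorIndex (r : α → α → Prop) [DecidableRel r] {n : ℕ} (w : Fin n → α) : ℕ :=
  -- Indices start at 0, so the index `j` of the second letter is the usual position of the first.
  ∑ i : Fin n, ∑ j : Fin n, if (i : ℕ) + 1 = j ∧ r (w i) (w j) then (j : ℕ) else 0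

/-- The number of occurrences of each letter. -/
def content [DecidableEq α] {n : ℕ} (w : Fin n → α) (a : α) : ℕ := ∑ i, if w i = a then 1 else 0

/-- `a` followed by `b` is out of order, equal odd letters being out of order. -/
def SuperGT [LT α] (odd : α → Prop) (a b : α) : Prop := b < a ∨ (a = b ∧ odd a)

instance [LinearOrder α] (odd : α → Prop) [DecidablePred odd] : DecidableRel (SuperGT odd) :=
  fun a b => inferInstanceAs (Decidable (b < a ∨ (a = b ∧ odd a)))

theorem inversions_snoc (r : α → α → Prop) [DecidableRel r] {n : ℕ} (w : Fin n → α) (x : α) :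
    inversions r (Fin.snoc w x : Fin (n + 1) → α) =
      inversions r w + ∑ i, if r (w i) x then 1 else 0 := by
  have h : ∀ j : Fin (n + 1), ¬ Fin.last n < j := fun j => not_lt.2 (Fin.le_last j)
  simp [inversions, Fin.sum_univ_castSucc, Finset.sum_add_distrib, h, -Finset.sum_boole]

theorem majorIndex_snoc (r : α → α → Prop) [DecidableRel r] {n : ℕ} (w : Fin n → α) (x : α) :
    majorIndex r (Fin.snoc w x : Fin (n + 1) → α) =
      majorIndex r w + ∑ i : Fin n, if (i : ℕ) + 1 = n ∧ r (w i) x then n else 0 := by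
  have h : ∀ j : Fin n, n + 1 ≠ (j : ℕ) := fun j => by omega
  simp [majorIndex, Fin.sum_univ_castSucc, Finset.sum_add_distrib, h]

theorem majorIndex_snoc_snoc (r : α → α → Prop) [DecidableRel r] {n : ℕ} (w : Fin n → α)
    (y x : α) :
    majorIndex r (Fin.snoc (Fin.snoc w y : Fin (n + 1) → α) x : Fin (n + 2) → α) =
      majorIndex r (Fin.snoc w y : Fin (n + 1) → α) + if r y x then n + 1 else 0 := by
  rw [majorIndex_snoc, Fin.sum_univ_castSucc]
  have h : ∀ j : Fin n, (j : ℕ) ≠ n := fun j => by omega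
  simp [h]

theorem content_snoc [DecidableEq α] {n : ℕ} (w : Fin n → α) (x : α) :
    content (Fin.snoc w x : Fin (n + 1) → α) = content w + Pi.single x 1 := by
  ext a
  simp [content, Fin.sum_univ_castSucc, Pi.single_apply, eq_comm (a := a), -Finset.sum_boole]

variable [Fintype α]

theorem sum_content_mul [DecidableEq α] {n : ℕ} (w : Fin n → α) (f : α → ℕ) :
    ∑ a, f a * content w a = ∑ i, f (w i) := by
  simp only [content, Finset.mul_sum]
  rw [Finset.sum_comm]
  simp

theorem sum_content [DecidableEq α] {n : ℕ} (w : Fin n → α) : ∑ a, content w a = n := by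
  simpa using sum_content_mul w 1

/-- Splitting off the last letter in a sum over words of given content. -/
theorem sum_words_snoc [DecidableEq α] {M : Type*} [AddCommMonoid M] {n : ℕ} (c : α → ℕ)
    (f : (Fin (n + 1) → α) → M) :
    (∑ w : Fin (n + 1) → α, if content w = c then f w else 0) =
      ∑ y, if 0 < c y then
        ∑ w : Fin n → α, if content w = c - Pi.single y 1 then f (Fin.snoc w y) else 0 else 0 := by
  rw [← (Fin.snocEquiv fun _ : Fin (n + 1) => α).sum_comp, Fintype.sum_prod_type]
  refine Finset.sum_congr rfl fun y _ => ?_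
  simp only [Fin.snocEquiv, Equiv.coe_fn_mk, content_snoc]
  -- If `y` occurs in `c`, the truncated subtraction is exact; otherwise no word of content `c` ends
  -- with `y`.
  split_ifs with h
  · refine Finset.sum_congr rfl fun w _ => if_congr ?_ rfl rfl
    constructor
    · rintro rfl; simp
    · rintro h'
      rw [h']
      ext a
      by_cases ha : a = y
      · subst ha; simp; omega
      · simp [ha]
  · refine Finset.sum_eq_zero fun w _ => if_neg ?_
    rintro rfl
    simp at h

end Words

/-! ### MacMahon's theorem with even and odd letters -/

section Weights

variable {𝕜 : Type*} [Field 𝕜]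

/-- `(1 - q)(1 - q²)⋯(1 - qⁿ)`. -/
def qFactorial (q : 𝕜) (n : ℕ) : 𝕜 := ∏ k ∈ Finset.range n, (1 - q ^ (k + 1))

theorem qFactorial_succ (q : 𝕜) (n : ℕ) :
    qFactorial q (n + 1) = qFactorial q n * (1 - q ^ (n + 1)) := Finset.prod_range_succ _ _

theorem qFactorial_ne_zero {q : 𝕜} (hq : ∀ k : ℕ, 1 - q ^ (k + 1) ≠ 0) (n : ℕ) :
    qFactorial q n ≠ 0 := Finset.prod_ne_zero_iff.2 fun k _ => hq k

/-- The values at the alphabet `1 / (1 - q)` of the complete (`b` false) and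
elementary (`b` true) symmetric functions. -/
def letterWeight (q : 𝕜) (b : Prop) [Decidable b] (n : ℕ) : 𝕜 :=
  (if b then q ^ n.choose 2 else 1) / qFactorial q n

@[simp] theorem letterWeight_zero (q : 𝕜) (b : Prop) [Decidable b] : letterWeight q b 0 = 1 := by
  simp [letterWeight, qFactorial]

theorem letterWeight_succ {q : 𝕜} (hq : ∀ k : ℕ, 1 - q ^ (k + 1) ≠ 0) (b : Prop) [Decidable b]
    (n : ℕ) : letterWeight q b (n + 1) * (1 - q ^ (n + 1)) =
      letterWeight q b n * if b then q ^ n else 1 := by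
  have h1 := hq n
  have h2 := qFactorial_ne_zero hq n
  have h3 : (n + 1).choose 2 = n + n.choose 2 := by simp [Nat.choose_succ_succ' n 1]
  rw [letterWeight, letterWeight, qFactorial_succ, h3]
  split_ifs <;> field_simp
  ring

variable {α : Type*} [Fintype α] [LinearOrder α]

/-- The generating function of words of content `c` by inversions. -/
def contentWeight (q : 𝕜) (odd : α → Prop) [DecidablePred odd] (c : α → ℕ) : 𝕜 :=
  qFactorial q (∑ a, c a) * ∏ a, letterWeight q (odd a) (c a)

/-- The number of letters of content `c` which form an inversion with a following `x`. -/
def countGT (odd : α → Prop) [DecidablePred odd] (c : α → ℕ) (x : α) : ℕ :=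
  ∑ y with SuperGT odd y x, c y

theorem countGT_eq (odd : α → Prop) [DecidablePred odd] (c : α → ℕ) (x : α) :
    countGT odd c x = (∑ y with x < y, c y) + if odd x then c x else 0 := by
  have h : ∀ y, (if SuperGT odd y x then c y else 0) =
      (if x < y then c y else 0) + if y = x then (if odd y then c y else 0) else 0 := by
    intro y
    unfold SuperGT
    by_cases hxy : y = x
    · subst hxy; simp
    · simp [hxy]
  simp only [countGT, Finset.sum_filter, h, Finset.sum_add_distrib]
  simp

theorem countGT_content (odd : α → Prop) [DecidablePred odd] {n : ℕ} (w : Fin n → α) (x : α) :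
    (∑ i, if SuperGT odd (w i) x then 1 else 0) = countGT odd (content w) x := by
  rw [← sum_content_mul w fun y => if SuperGT odd y x then 1 else 0]
  simp [countGT, Finset.sum_filter]

/-- For odd `y` the ratio of elementary weights carries a factor q^(c y), exactly the inversions
between the new `y` and the earlier copies. The parity of `y` thus cancels from the recursion. -/
theorem contentWeight_add_single {q : 𝕜} (hq : ∀ k : ℕ, 1 - q ^ (k + 1) ≠ 0) (odd : α → Prop)
    [DecidablePred odd] (c : α → ℕ) (y : α) :
    q ^ countGT odd c y * contentWeight q odd c * (1 - q ^ (∑ a, c a + 1)) =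
      q ^ (∑ z with y < z, c z) * (1 - q ^ (c y + 1)) *
        contentWeight q odd (c + Pi.single y 1) := by
  have hsum : ∑ a, (c + Pi.single y 1 : α → ℕ) a = ∑ a, c a + 1 := by
    simp [Finset.sum_add_distrib]
  have hprod : ∏ a, letterWeight q (odd a) ((c + Pi.single y 1 : α → ℕ) a) =
      letterWeight q (odd y) (c y + 1) *
        ∏ a ∈ Finset.univ.erase y, letterWeight q (odd a) (c a) := by
    rw [← Finset.mul_prod_erase _ _ (Finset.mem_univ y)]
    congr 1
    · simp
    · refine Finset.prod_congr rfl fun a ha => ?_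
      simp [Finset.ne_of_mem_erase ha]
  have hl := letterWeight_succ hq (odd y) (c y)
  have hG : q ^ countGT odd c y =
      q ^ (∑ z with y < z, c z) * if odd y then q ^ c y else 1 := by
    rw [countGT_eq, pow_add]
    congr 1
    split_ifs <;> simp
  rw [contentWeight, contentWeight, hsum, qFactorial_succ,
    hprod, ← Finset.mul_prod_erase _ _ (Finset.mem_univ y), hG]
  linear_combination -(q ^ (∑ z with y < z, c z) * qFactorial q (∑ a, c a) *
    (1 - q ^ (∑ a, c a + 1)) * ∏ a ∈ Finset.univ.erase y, letterWeight q (odd a) (c a)) * hl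

omit [Fintype α] in
-- The summand is q^(letters above y) - q^(letters at or above y), so consecutive terms cancel.
theorem sum_telescope (q : 𝕜) (c : α → ℕ) (S : Finset α) :
    ∑ y ∈ S, q ^ (∑ z ∈ S with y < z, c z) * (1 - q ^ c y) = 1 - q ^ (∑ y ∈ S, c y) := by
  induction S using Finset.induction_on_min with
  | empty => simp
  | insert a S ha ih =>
    have haS : a ∉ S := fun h => lt_irrefl _ (ha a h)
    rw [Finset.sum_insert haS, Finset.sum_insert haS]
    have h1 : (insert a S).filter (a < ·) = S := by
      rw [Finset.filter_insert, if_neg (lt_irrefl a), Finset.filter_true_of_mem ha]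
    have h2 : ∀ y ∈ S, (insert a S).filter (y < ·) = S.filter (y < ·) := fun y hy => by
      rw [Finset.filter_insert, if_neg (ha y hy).not_gt]
    have h3 : ∑ y ∈ S, q ^ (∑ z ∈ insert a S with y < z, c z) * (1 - q ^ c y) =
        1 - q ^ (∑ y ∈ S, c y) := by
      rw [← ih]
      exact Finset.sum_congr rfl fun y hy => by rw [h2 y hy]
    rw [h1, h3, pow_add]
    ring

/-- The contribution to the generating function of words of content `c` of the words ending
with `y`. -/
theorem contentWeight_sub_single {q : 𝕜} (hq : ∀ k : ℕ, 1 - q ^ (k + 1) ≠ 0) (odd : α → Prop)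
    [DecidablePred odd] {n : ℕ} {c : α → ℕ} (hc : ∑ a, c a = n + 1) (y : α) :
    (if 0 < c y then q ^ countGT odd (c - Pi.single y 1) y *
      contentWeight q odd (c - Pi.single y 1) else 0) =
      q ^ (∑ z with y < z, c z) * (1 - q ^ c y) * (contentWeight q odd c / (1 - q ^ (n + 1))) := by
  split_ifs with h
  · obtain ⟨d, rfl⟩ : ∃ d : α → ℕ, c = d + Pi.single y 1 := by
      refine ⟨c - Pi.single y 1, ?_⟩
      ext a
      by_cases ha : a = y
      · subst ha; simp; omega
      · simp [ha]
    have hd : ∑ a, d a = n := by simpa [Finset.sum_add_distrib] using hc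
    have key := contentWeight_add_single hq odd d y
    rw [hd] at key
    have hs : ∑ z with y < z, (d + Pi.single y 1 : α → ℕ) z = ∑ z with y < z, d z := by
      refine Finset.sum_congr rfl fun z hz => ?_
      have : z ≠ y := (Finset.mem_filter.1 hz).2.ne'
      simp [this]
    rw [add_tsub_cancel_right, hs]
    simp only [Pi.add_apply, Pi.single_eq_same]
    rw [← mul_div_assoc, eq_div_iff (hq n), key]
  · simp [Nat.eq_zero_of_not_pos h]

theorem sum_contentWeight {q : 𝕜} (hq : ∀ k : ℕ, 1 - q ^ (k + 1) ≠ 0) (odd : α → Prop)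
    [DecidablePred odd] {n : ℕ} {c : α → ℕ} (hc : ∑ a, c a = n + 1) :
    (∑ y, if 0 < c y then q ^ countGT odd (c - Pi.single y 1) y *
      contentWeight q odd (c - Pi.single y 1) else 0) = contentWeight q odd c := by
  simp only [contentWeight_sub_single hq odd hc]
  rw [← Finset.sum_mul, sum_telescope q c Finset.univ, hc, mul_div_cancel₀ _ (hq n)]

/-- The letters out of order before `x` form an upper set, of total multiplicity G = `countGT odd c
x`. Up to the common factor, telescoping gives q^(n+1) (1 - q^G) on this set and q^G - q^(n+1) on
its complement, with sum q^G (1 - q^(n+1)). -/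
theorem sum_contentWeight_last {q : 𝕜} (hq : ∀ k : ℕ, 1 - q ^ (k + 1) ≠ 0) (odd : α → Prop)
    [DecidablePred odd] {n : ℕ} {c : α → ℕ} (hc : ∑ a, c a = n + 1) (x : α) :
    (∑ y, (q ^ if SuperGT odd y x then n + 1 else 0) *
      if 0 < c y then q ^ countGT odd (c - Pi.single y 1) y *
        contentWeight q odd (c - Pi.single y 1) else 0) =
      q ^ countGT odd c x * contentWeight q odd c := by
  simp only [contentWeight_sub_single hq odd hc]
  have h1 := sum_telescope q c {y | SuperGT odd y x}
  have h2 := sum_telescope q c {y | ¬ SuperGT odd y x}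
  have hsplit := Finset.sum_filter_add_sum_filter_not Finset.univ (SuperGT odd · x) c
  have e1 : ∀ y ∈ ({y | SuperGT odd y x} : Finset α),
      (({y | SuperGT odd y x} : Finset α).filter (y < ·)) = ({z | y < z} : Finset α) := by
    intro y hy
    ext z
    simp only [Finset.mem_filter, Finset.mem_univ, true_and] at hy ⊢
    unfold SuperGT at hy ⊢
    refine ⟨fun h => h.2, fun h => ⟨Or.inl ?_, h⟩⟩
    rcases hy with hy | ⟨rfl, -⟩
    · exact hy.trans h
    · exact h
  have e2 : ∀ y ∈ ({y | ¬ SuperGT odd y x} : Finset α),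
      ∑ z with y < z, c z = countGT odd c x +
        ∑ z ∈ ({y | ¬ SuperGT odd y x} : Finset α) with y < z, c z := by
    intro y hy
    rw [countGT, ← Finset.sum_filter_add_sum_filter_not ({z | y < z} : Finset α)
      (SuperGT odd · x)]
    congr 1
    · refine Finset.sum_congr ?_ fun _ _ => rfl
      ext z
      simp only [Finset.mem_filter, Finset.mem_univ, true_and] at hy ⊢
      unfold SuperGT at hy ⊢
      refine ⟨fun h => h.2, fun h => ⟨?_, h⟩⟩
      push Not at hy
      rcases h with h | ⟨rfl, h⟩
      · exact hy.1.trans_lt h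
      · exact lt_of_le_of_ne hy.1 fun e => hy.2 e (e ▸ h)
    · rw [Finset.filter_comm]
  rw [← Finset.sum_filter_add_sum_filter_not Finset.univ (SuperGT odd · x)]
  have s1 : ∑ y with SuperGT odd y x, (q ^ if SuperGT odd y x then n + 1 else 0) *
      (q ^ (∑ z with y < z, c z) * (1 - q ^ c y) * (contentWeight q odd c / (1 - q ^ (n + 1)))) =
      q ^ (n + 1) * (1 - q ^ countGT odd c x) * (contentWeight q odd c / (1 - q ^ (n + 1))) := by
    rw [countGT, ← h1, Finset.mul_sum, Finset.sum_mul]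
    refine Finset.sum_congr rfl fun y hy => ?_
    rw [e1 y hy, if_pos (Finset.mem_filter.1 hy).2]
    ring
  have s2 : ∑ y with ¬ SuperGT odd y x, (q ^ if SuperGT odd y x then n + 1 else 0) *
      (q ^ (∑ z with y < z, c z) * (1 - q ^ c y) * (contentWeight q odd c / (1 - q ^ (n + 1)))) =
      (q ^ countGT odd c x - q ^ (n + 1)) * (contentWeight q odd c / (1 - q ^ (n + 1))) := by
    rw [← hc, ← hsplit, pow_add, show ∑ y with SuperGT odd y x, c y = countGT odd c x from rfl,
      ← mul_one_sub, ← h2, Finset.mul_sum, Finset.sum_mul]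
    refine Finset.sum_congr rfl fun y hy => ?_
    rw [e2 y hy, if_neg (Finset.mem_filter.1 hy).2, pow_add]
    ring
  rw [s1, s2]
  have := hq n
  field_simp
  ring

omit [LinearOrder α] in
theorem contentWeight_of_sum_eq_zero (q : 𝕜) (odd : α → Prop) [DecidablePred odd] {c : α → ℕ}
    (hc : ∑ a, c a = 0) : contentWeight q odd c = 1 := by
  have h : ∀ a, c a = 0 := by simpa using hc
  simp [contentWeight, h, qFactorial]

theorem sum_sub_single {n : ℕ} {c : α → ℕ} (hc : ∑ a, c a = n + 1) {y : α} (hy : 0 < c y) :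
    ∑ a, (c - Pi.single y 1 : α → ℕ) a = n := by
  have h : ∀ a ∈ Finset.univ, (Pi.single y 1 : α → ℕ) a ≤ c a := by
    intro a _
    by_cases ha : a = y
    · subst ha; simpa using Nat.succ_le_of_lt hy
    · simp [ha]
  simp only [Pi.sub_apply]
  rw [Finset.sum_tsub_distrib _ h, hc]
  simp

/-- MacMahon's theorem for inversions of words on even and odd letters. -/
theorem sum_pow_inversions {q : 𝕜} (hq : ∀ k : ℕ, 1 - q ^ (k + 1) ≠ 0) (odd : α → Prop)
    [DecidablePred odd] {n : ℕ} {c : α → ℕ} (hc : ∑ a, c a = n) :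
    (∑ w : Fin n → α, if content w = c then q ^ inversions (SuperGT odd) w else 0) =
      contentWeight q odd c := by
  induction n generalizing c with
  | zero =>
    have h : ∀ a, c a = 0 := by simpa using hc
    have : ∀ w : Fin 0 → α, content w = c := fun w => funext fun a => by simp [content, h]
    simp [this, inversions, contentWeight_of_sum_eq_zero q odd hc]
  | succ n ih =>
    rw [sum_words_snoc, ← sum_contentWeight hq odd hc]
    refine Finset.sum_congr rfl fun y _ => ?_
    split_ifs with hy
    · rw [← ih (sum_sub_single hc hy), Finset.mul_sum]
      refine Finset.sum_congr rfl fun w _ => ?_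
      split_ifs with hw
      · rw [inversions_snoc, countGT_content, hw, pow_add, mul_comm]
      · simp
    · rfl

/-- The major index sees only the neighbour of a new letter, so the induction must keep track of the
letter `x` that follows. The right side is also what inversions give when `x` is appended. -/
theorem sum_pow_majorIndex_snoc {q : 𝕜} (hq : ∀ k : ℕ, 1 - q ^ (k + 1) ≠ 0) (odd : α → Prop)
    [DecidablePred odd] {n : ℕ} {c : α → ℕ} (hc : ∑ a, c a = n) (x : α) :
    (∑ w : Fin n → α, if content w = c then
      q ^ majorIndex (SuperGT odd) (Fin.snoc w x : Fin (n + 1) → α) else 0) =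
      q ^ countGT odd c x * contentWeight q odd c := by
  induction n generalizing c x with
  | zero =>
    have h : ∀ a, c a = 0 := by simpa using hc
    have : ∀ w : Fin 0 → α, content w = c := fun w => funext fun a => by simp [content, h]
    simp [this, majorIndex, contentWeight_of_sum_eq_zero q odd hc, countGT, h]
  | succ n ih =>
    rw [sum_words_snoc, ← sum_contentWeight_last hq odd hc]
    refine Finset.sum_congr rfl fun y _ => ?_
    by_cases hy : 0 < c y
    · rw [if_pos hy, if_pos hy, ← ih (sum_sub_single hc hy), Finset.mul_sum]
      refine Finset.sum_congr rfl fun w _ => ?_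
      rw [mul_ite, mul_zero, ← pow_add, majorIndex_snoc_snoc, add_comm]
    · rw [if_neg hy, if_neg hy, mul_zero]

/-- MacMahon's theorem for the major index of words on even and odd letters. -/
theorem sum_pow_majorIndex {q : 𝕜} (hq : ∀ k : ℕ, 1 - q ^ (k + 1) ≠ 0) (odd : α → Prop)
    [DecidablePred odd] {n : ℕ} {c : α → ℕ} (hc : ∑ a, c a = n) :
    (∑ w : Fin n → α, if content w = c then q ^ majorIndex (SuperGT odd) w else 0) =
      contentWeight q odd c := by
  cases n with
  | zero =>
    have h : ∀ a, c a = 0 := by simpa using hc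
    have : ∀ w : Fin 0 → α, content w = c := fun w => funext fun a => by simp [content, h]
    simp [this, majorIndex, contentWeight_of_sum_eq_zero q odd hc]
  | succ n =>
    rw [sum_words_snoc, ← sum_contentWeight hq odd hc]
    refine Finset.sum_congr rfl fun y _ => ?_
    split_ifs with hy
    · rw [← sum_pow_majorIndex_snoc hq odd (sum_sub_single hc hy)]
    · rfl

end Weights

/-! ### Generating series -/

section Series

open PowerSeries

/-- Comparing coefficients in K' = (∑ A_(k+1) z^k) K gives the recursion that defines `completeHom`.
-/
theorem evalAt_completeHom {S : Type*} [CommRing S] [Algebra ℚ S] (A : ℕ+ → S) {K : S⟦X⟧}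
    (h0 : coeff 0 K = 1) (hK : derivative S K = mk (fun k => A k.succPNat) * K) (n : ℕ) :
    evalAt A (completeHom n) = coeff n K := by
  induction n using Nat.strong_induction_on with
  | _ n ih =>
    cases n with
    | zero => simp [completeHom, h0]
    | succ n =>
      have h := congrArg (coeff n) hK
      rw [coeff_derivative, coeff_mul, Finset.Nat.sum_antidiagonal_eq_sum_range_succ_mk,
        ← Fin.sum_univ_eq_sum_range (fun k => coeff k (mk fun k => A k.succPNat) *
          coeff (n - k) K)] at h
      have : ∀ k : Fin (n + 1), evalAt A (powerSum (Nat.succPNat k) * completeHom (n - k)) =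
          coeff k (mk fun k => A k.succPNat) * coeff (n - k) K := by
        intro k
        rw [map_mul, ih (n - k) (by omega)]
        simp [evalAt, powerSum]
      rw [completeHom, map_smul, map_sum, Finset.sum_congr rfl fun k _ => this k, ← h,
        inv_smul_eq_iff₀ (by positivity), Algebra.smul_def]
      simp [mul_comm]

theorem evalAt_lagrange {S : Type*} [CommRing S] [Algebra ℚ S] (A : ℕ+ → S) {K : S⟦X⟧}
    (h0 : coeff 0 K = 1) (hK : derivative S K = mk (fun k => A k.succPNat) * K) (n : ℕ) :
    evalAt A (lagrange n) = ((n : ℚ) + 1)⁻¹ • coeff n (K ^ (n + 1)) := by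
  have hcomp : (evalAt A).comp (evalAt fun k : ℕ+ => ((n : ℚ) + 1) • powerSum k) =
      evalAt fun k => ((n : ℚ) + 1) • A k := by
    refine MvPolynomial.algHom_ext fun k => ?_
    simp [evalAt, powerSum]
  rw [lagrange, map_smul, ← AlgHom.comp_apply, hcomp, evalAt_completeHom (K := K ^ (n + 1))]
  · rw [coeff_zero_eq_constantCoeff] at h0 ⊢
    simp [h0]
  · rw [derivative_pow, hK]
    have : (mk fun k => ((n : ℚ) + 1) • A k.succPNat) =
        ((n + 1 : ℕ) : S⟦X⟧) * mk fun k => A k.succPNat := by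
      ext k
      rw [← nsmul_eq_mul, map_nsmul, coeff_mk, coeff_mk, Algebra.smul_def, nsmul_eq_mul]
      simp
    rw [this]
    simp
    ring

theorem derivative_rescale {S : Type*} [CommRing S] (q : S) (K : S⟦X⟧) :
    derivative S (rescale q K) = C q * rescale q (derivative S K) := by
  ext n
  simp [coeff_derivative, coeff_rescale, pow_succ]
  ring

/-- The logarithmic derivative of a series with `(1 - z) K(z) = (1 - xz) K(qz)`. -/
theorem derivative_eq_of_qDifference {S : Type*} [CommRing S] [IsDomain S] {q x : S}
    (hq : ∀ k : ℕ, 1 - q ^ (k + 1) ≠ 0) {A : ℕ+ → S}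
    (hA : ∀ k : ℕ+, (1 - q ^ (k : ℕ)) * A k = 1 - x ^ (k : ℕ)) {K : S⟦X⟧} (h0 : coeff 0 K = 1)
    (hK : (1 - X) * K = (1 - C x * X) * rescale q K) :
    derivative S K = mk (fun k => A k.succPNat) * K := by
  obtain ⟨J, hJ⟩ : ∃ J, K * J = 1 :=
    ⟨invOfUnit K 1, mul_invOfUnit K 1 (by simpa using h0)⟩
  have hK0 : K ≠ 0 := by rintro rfl; simp at hJ
  -- L is the logarithmic derivative K'/K.
  set L := derivative S K * J with hL
  have hLK : derivative S K = L * K := by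
    rw [hL, mul_assoc, mul_comm J, hJ, mul_one]
  have hd := congrArg (derivative S) hK
  have hx1 : (1 - X : S⟦X⟧) ≠ 0 := fun h => by
    simpa using congrArg (coeff 0) h
  have hx2 : (1 - C x * X : S⟦X⟧) ≠ 0 := fun h => by
    simpa using congrArg (coeff 0) h
  simp only [Derivation.leibniz, map_sub, derivative_X, derivative_C, smul_eq_mul,
    derivative_rescale, hLK, map_mul, Derivation.map_one_eq_zero] at hd
  -- Logarithmic differentiation of the q-difference equation, with the denominators cleared.
  have key : (1 - X) * (1 - C x * X) * (L - C q * rescale q L) = 1 - C x := by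
    refine mul_right_cancel₀ hK0 ?_
    linear_combination (1 - C x * X) * hd + (C x - (1 - C x * X) * C q * rescale q L) * hK
  -- Partial fractions: (1-x)/((1-z)(1-xz)) = 1/(1-z) - x/(1-xz).
  have key2 : (1 - X) * (1 - C x * X) * (mk fun k => 1 - x ^ (k + 1)) = 1 - C x := by
    have e1 : (1 - X) * mk (fun _ => (1 : S)) = 1 := by
      rw [mul_comm]; exact mk_one_mul_one_sub_eq_one S
    have e2 : (1 - C x * X) * mk (fun k => x ^ k) = 1 := by
      have := congrArg (rescale x) e1
      simpa [rescale_mk, rescale_X] using this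
    have e3 : (mk fun k => 1 - x ^ (k + 1)) = mk (fun _ => (1 : S)) - C x * mk fun k => x ^ k := by
      ext k; simp [pow_succ']
    rw [e3]
    linear_combination (1 - C x * X) * e1 - C x * (1 - X) * e2
  have hmain := mul_left_cancel₀ (mul_ne_zero hx1 hx2) (key.trans key2.symm)
  rw [hLK]
  congr 1
  ext k
  refine mul_left_cancel₀ (hq k) ?_
  have h1 := congrArg (coeff k) hmain
  simp only [map_sub, coeff_C_mul, coeff_rescale, coeff_mk] at h1
  have h2 := hA k.succPNat
  simp only [Nat.succPNat_coe, Nat.succ_eq_add_one] at h2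
  rw [coeff_mk, h2, ← h1]
  ring

variable {𝕜 : Type*} [Field 𝕜]

/-- The generating series of the complete homogeneous symmetric functions of
`(1 - x) / (1 - q)` at `x = -t`. -/
noncomputable def superSeries (q : 𝕜) : 𝕜[X]⟦X⟧ :=
  mk (fun n => Polynomial.C (letterWeight q False n)) *
    mk (fun n => Polynomial.C (letterWeight q True n) * Polynomial.X ^ n)

theorem coeff_superSeries (q : 𝕜) (n : ℕ) :
    coeff n (superSeries q) = ∑ p ∈ Finset.HasAntidiagonal.antidiagonal n,
      Polynomial.C (letterWeight q False p.1 * letterWeight q True p.2) * Polynomial.X ^ p.2 := by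
  rw [superSeries, coeff_mul]
  refine Finset.sum_congr rfl fun p _ => ?_
  simp [mul_assoc]

/-- The factors H and E satisfy (1-z) H(z) = H(qz) and E(z) = (1+tz) E(qz), by the ratio of
consecutive weights. -/
theorem superSeries_qDifference {q : 𝕜} (hq : ∀ k : ℕ, 1 - q ^ (k + 1) ≠ 0) :
    (1 - X) * superSeries q =
      (1 - C (-Polynomial.X) * X) * rescale (Polynomial.C q) (superSeries q) := by
  have h1 : (1 - X) * mk (fun n => Polynomial.C (letterWeight q False n)) =
      rescale (Polynomial.C q) (mk (fun n => Polynomial.C (letterWeight q False n))) := by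
    ext1 n
    rw [sub_mul, one_mul, map_sub, coeff_rescale]
    cases n with
    | zero => simp
    | succ n =>
      have := letterWeight_succ hq False n
      simp only [if_false, mul_one] at this
      rw [coeff_succ_X_mul, coeff_mk, coeff_mk, ← this, ← Polynomial.C_pow, ← Polynomial.C_mul,
        ← Polynomial.C_sub]
      congr 1
      ring
  have h2 : mk (fun n => Polynomial.C (letterWeight q True n) * Polynomial.X ^ n) =
      (1 - C (-Polynomial.X) * X) * rescale (Polynomial.C q)
        (mk (fun n => Polynomial.C (letterWeight q True n) * Polynomial.X ^ n)) := by
    ext1 n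
    rw [sub_mul, one_mul, map_sub, coeff_rescale, mul_assoc, coeff_C_mul]
    cases n with
    | zero => simp
    | succ n =>
      have := congrArg Polynomial.C (letterWeight_succ hq True n)
      simp only [if_true] at this
      rw [coeff_succ_X_mul, coeff_rescale, coeff_mk, coeff_mk]
      simp only [Polynomial.C_mul, Polynomial.C_sub, Polynomial.C_pow, Polynomial.C_1] at this ⊢
      linear_combination Polynomial.X ^ (n + 1) * this
  rw [superSeries, map_mul, ← mul_assoc, h1]
  nth_rw 1 [h2]
  ring

theorem derivative_superSeries {q : 𝕜} (hq : ∀ k : ℕ, 1 - q ^ (k + 1) ≠ 0) :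
    derivative 𝕜[X] (superSeries q) = mk (fun k => Polynomial.C (1 - q ^ (k.succPNat : ℕ))⁻¹ *
      (1 - (-Polynomial.X) ^ (k.succPNat : ℕ))) * superSeries q := by
  refine derivative_eq_of_qDifference (q := Polynomial.C q) (x := -Polynomial.X)
    (A := fun k => Polynomial.C (1 - q ^ (k : ℕ))⁻¹ * (1 - (-Polynomial.X) ^ (k : ℕ))) ?_ ?_ ?_
    (superSeries_qDifference hq)
  · intro k h
    refine hq k (Polynomial.C_injective ?_)
    simpa using h
  · intro k
    have hk : 1 - q ^ (k : ℕ) ≠ 0 := by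
      simpa [Nat.sub_add_cancel k.pos] using hq (k - 1 : ℕ)
    rw [← mul_assoc, ← Polynomial.C_pow, ← Polynomial.C_1, ← Polynomial.C_sub, ← Polynomial.C_mul,
      mul_inv_cancel₀ hk]
    simp
  · rw [coeff_superSeries]
    simp

theorem evalAt_lagrange_super [Algebra ℚ 𝕜[X]] {q : 𝕜} (hq : ∀ k : ℕ, 1 - q ^ (k + 1) ≠ 0)
    (n : ℕ) :
    evalAt (fun k : ℕ+ => Polynomial.C (1 - q ^ (k : ℕ))⁻¹ * (1 - (-Polynomial.X) ^ (k : ℕ)))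
      (lagrange n) = ((n : ℚ) + 1)⁻¹ • coeff n (superSeries q ^ (n + 1)) :=
  evalAt_lagrange
    (fun k : ℕ+ => Polynomial.C (1 - q ^ (k : ℕ))⁻¹ * (1 - (-Polynomial.X) ^ (k : ℕ)))
    (K := superSeries q) (by rw [coeff_superSeries]; simp) (derivative_superSeries hq) n

end Series

/-! ### The super-Narayana polynomial as a sum over weak compositions -/

theorem coeff_pow_card {S : Type*} [CommSemiring S] (ι : Type*) [Fintype ι] [DecidableEq ι]
    (K : PowerSeries S) (n : ℕ) :
    PowerSeries.coeff n (K ^ Fintype.card ι) =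
      ∑ m ∈ Finset.piAntidiag (Finset.univ : Finset ι) n, ∏ i, PowerSeries.coeff (m i) K := by
  rw [← Finset.card_univ, ← Finset.prod_const, PowerSeries.coeff_prod, Finset.finsuppAntidiag,
    Finset.sum_map, ← Finset.sum_attach (Finset.piAntidiag _ _)]
  rfl

theorem one_sub_q_pow_ne_zero (k : ℕ) : 1 - q ^ (k + 1) ≠ 0 := by
  intro h
  have h1 : (Polynomial.X : ℚ[X]) ^ (k + 1) = 1 := by
    refine IsFractionRing.injective ℚ[X] (RatFunc ℚ) ?_
    simpa using (sub_eq_zero.1 h).symm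
  have := congrArg (Polynomial.eval 0) h1
  simp at this

theorem evalAt_superAlphabet_comp (f : SymFun) :
    (evalAt superAlphabet f).comp (-Polynomial.X) =
      evalAt (fun k : ℕ+ => Polynomial.C (1 - q ^ (k : ℕ))⁻¹ *
        (1 - (-Polynomial.X) ^ (k : ℕ))) f := by
  induction f using MvPolynomial.induction_on with
  | C a =>
    change (evalAt superAlphabet (algebraMap ℚ SymFun a)).comp _ =
      evalAt _ (algebraMap ℚ SymFun a)
    rw [AlgHom.commutes, AlgHom.commutes]
    exact RingHom.congr_fun (RingHom.ext_rat ((Polynomial.compRingHom (-Polynomial.X)).comp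
      (algebraMap ℚ (RatFunc ℚ)[X])) _) a
  | add f g hf hg => rw [map_add, map_add, Polynomial.add_comp, hf, hg]
  | mul_X f k hf =>
    rw [map_mul, map_mul, Polynomial.mul_comp, hf]
    simp [evalAt, superAlphabet]

theorem superNarayana_eq (n : ℕ) :
    superNarayana n = Polynomial.C (qFactorial q n) * (((n : ℚ) + 1)⁻¹ •
      ∑ m ∈ Finset.piAntidiag (Finset.univ : Finset (Fin (n + 1))) n,
        ∏ i, PowerSeries.coeff (m i) (superSeries q)) := by
  have hq : qPochhammer n = qFactorial q n := by
    rw [qPochhammer, qFactorial, Finset.range_eq_Ico, Finset.prod_Ico_add' (fun k => 1 - q ^ k)]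
    rfl
  have h := evalAt_lagrange_super one_sub_q_pow_ne_zero n
  have h' := coeff_pow_card (Fin (n + 1)) (superSeries q) n
  rw [Fintype.card_fin] at h'
  rw [superNarayana, hq, evalAt_superAlphabet_comp, h, h']

/-! ### The cycle lemma -/

/-- `m i` letters equal to `i + 1`, for `0 ≤ i ≤ n`, form a parking function. -/
def IsParkingContent {n : ℕ} (m : Fin (n + 1) → ℕ) : Prop :=
  ∀ j ≤ n, j ≤ ∑ i ∈ Finset.range j, m (Fin.ofNat (n + 1) i)

/-- The periodic potential whose minima are the starting points of parking contents. -/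
def potential {n : ℕ} (m : Fin (n + 1) → ℕ) (k : ℕ) : ℤ :=
  (n + 1) * ∑ i ∈ Finset.range k, (m (Fin.ofNat (n + 1) i) : ℤ) - n * k

theorem ofNat_add_eq {n : ℕ} (i k : ℕ) :
    Fin.ofNat (n + 1) i + Fin.ofNat (n + 1) k = Fin.ofNat (n + 1) (i + k) := by
  ext; simp [Fin.val_add]

theorem sum_range_period {n : ℕ} {m : Fin (n + 1) → ℕ} (hm : ∑ i, m i = n) :
    ∑ i ∈ Finset.range (n + 1), (m (Fin.ofNat (n + 1) i) : ℤ) = n := by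
  rw [Finset.sum_range]
  simp only [Fin.ofNat_eq_cast, Fin.cast_val_eq_self]
  exact_mod_cast hm

theorem potential_add_period {n : ℕ} {m : Fin (n + 1) → ℕ} (hm : ∑ i, m i = n) (k : ℕ) :
    potential m (k + (n + 1)) = potential m k := by
  have h : ∀ i, Fin.ofNat (n + 1) (n + 1 + i) = Fin.ofNat (n + 1) i := fun i => by
    ext; simp
  rw [potential, potential, add_comm k, Finset.sum_range_add, sum_range_period hm]
  simp only [h]
  push_cast
  ring

/-- If s is the sum of the j parts starting at k, the potential rises by (n+1)(s-j) + j. Since 0 ≤ j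
≤ n, this is nonnegative exactly when s ≥ j. -/
theorem isParkingContent_rotate_iff {n : ℕ} (m : Fin (n + 1) → ℕ) (k : ℕ) :
    IsParkingContent (fun i => m (i + Fin.ofNat (n + 1) k)) ↔
      ∀ j ≤ n, potential m k ≤ potential m (k + j) := by
  refine forall₂_congr fun j hj => ?_
  have h : potential m (k + j) - potential m k =
      (n + 1) * ((∑ i ∈ Finset.range j, m (Fin.ofNat (n + 1) i + Fin.ofNat (n + 1) k) : ℕ) - j : ℤ)
        + j := by
    simp only [potential, ofNat_add_eq, Finset.sum_range_add, add_comm _ k]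
    push_cast
    ring
  rw [← sub_nonneg (b := potential m k), h, ← Nat.cast_le (α := ℤ)]
  generalize ((∑ i ∈ Finset.range j, m (Fin.ofNat (n + 1) i + Fin.ofNat (n + 1) k) : ℕ) : ℤ) = s
  constructor
  · intro hs
    have := mul_nonneg (by positivity : (0 : ℤ) ≤ n + 1) (sub_nonneg.2 hs)
    omega
  · intro hs
    by_contra! hlt
    have : ((n : ℤ) + 1) * (s - j) ≤ (n + 1) * (-1) :=
      mul_le_mul_of_nonneg_left (by omega) (by positivity)
    omega

/-- The cycle lemma: exactly one rotation of `m` is a parking content. -/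
theorem existsUnique_rotation {n : ℕ} {m : Fin (n + 1) → ℕ} (hm : ∑ i, m i = n) :
    ∃! k : Fin (n + 1), IsParkingContent fun i => m (i + k) := by
  have hcast : ∀ k : Fin (n + 1), Fin.ofNat (n + 1) k = k := fun k => by simp
  have hiff : ∀ k : Fin (n + 1), (IsParkingContent fun i => m (i + k)) ↔
      ∀ j ≤ n, potential m k ≤ potential m (k + j) := fun k => by
    rw [← isParkingContent_rotate_iff, hcast]
  have hstrict : ∀ j k : Fin (n + 1), j < k → (IsParkingContent fun i => m (i + j)) →
      ¬ IsParkingContent fun i => m (i + k) := by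
    intro j k hjk hj hk
    rw [Fin.lt_def] at hjk
    have hle := (hiff j).1 hj (k - j) (by omega)
    have hge := (hiff k).1 hk (j + (n + 1) - k) (by omega)
    rw [show (j : ℕ) + (k - j) = k by omega] at hle
    rw [show (k : ℕ) + (j + (n + 1) - k) = j + (n + 1) by omega, potential_add_period hm] at hge
    have heq := le_antisymm hle hge
    unfold potential at heq
    -- Equal potentials give (n+1)(S_k - S_j) = n(k-j) for the partial sums S, so n+1 divides k-j,
    -- although 0 < k-j ≤ n.
    have hdvd : ((n : ℤ) + 1) ∣ k - j := by
      refine ⟨(k - j) - (∑ i ∈ Finset.range k, (m (Fin.ofNat (n + 1) i) : ℤ) -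
        ∑ i ∈ Finset.range j, (m (Fin.ofNat (n + 1) i) : ℤ)), ?_⟩
      linear_combination -heq
    have := Int.le_of_dvd (by omega) hdvd
    omega
  -- A minimum over one period is a global minimum by periodicity.
  obtain ⟨k, -, hk⟩ := Finset.exists_min_image (Finset.univ : Finset (Fin (n + 1)))
    (fun k => potential m k) ⟨0, Finset.mem_univ _⟩
  have hmin : ∀ j : ℕ, potential m k ≤ potential m j := by
    intro j
    induction j using Nat.strong_induction_on with
    | _ j ih =>
      by_cases h : j < n + 1
      · exact hk ⟨j, h⟩ (Finset.mem_univ _)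
      · rw [← Nat.sub_add_cancel (not_lt.1 h), potential_add_period hm]
        exact ih _ (by omega)
  refine ⟨k, (hiff k).2 fun j _ => hmin _, fun j hj => ?_⟩
  rcases lt_trichotomy j k with h | h | h
  · exact absurd ((hiff k).2 fun j _ => hmin _) (hstrict j k h hj)
  · exact h
  · exact absurd hj (hstrict k j h ((hiff k).2 fun j _ => hmin _))

-- Each `m` is charged to its unique parking rotation. After exchanging the sums, every rotation
-- amount contributes the same total.
open Classical in
theorem sum_isParkingContent {M : Type*} [AddCommMonoid M] {n : ℕ}
    (w : (Fin (n + 1) → ℕ) → M) (hw : ∀ m k, w (fun i => m (i + k)) = w m) :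
    (∑ m ∈ Finset.piAntidiag (Finset.univ : Finset (Fin (n + 1))) n, w m) =
      (n + 1) • ∑ m ∈ Finset.piAntidiag (Finset.univ : Finset (Fin (n + 1))) n with
        IsParkingContent m, w m := by
  have h1 : ∀ m ∈ Finset.piAntidiag (Finset.univ : Finset (Fin (n + 1))) n,
      w m = ∑ k, if IsParkingContent (fun i => m (i + k)) then w (fun i => m (i + k)) else 0 := by
    intro m hm
    obtain ⟨k, hk, huniq⟩ := existsUnique_rotation (by simpa using hm)
    rw [Finset.sum_eq_single k]
    · rw [if_pos hk, hw]
    · intro j _ hj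
      exact if_neg fun h => hj (huniq j h)
    · simp
  rw [Finset.sum_congr rfl h1, Finset.sum_comm]
  have h2 : ∀ k : Fin (n + 1), (∑ m ∈ Finset.piAntidiag (Finset.univ : Finset (Fin (n + 1))) n,
      if IsParkingContent (fun i => m (i + k)) then w (fun i => m (i + k)) else 0) =
      ∑ m ∈ Finset.piAntidiag (Finset.univ : Finset (Fin (n + 1))) n with
        IsParkingContent m, w m := by
    intro k
    rw [Finset.sum_filter]
    refine Finset.sum_equiv ((Equiv.subRight k).arrowCongr (Equiv.refl ℕ)) ?_ ?_
    · intro m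
      simp only [Finset.mem_piAntidiag, Equiv.arrowCongr_apply, Equiv.coe_refl,
        Function.id_comp, Finset.mem_univ, implies_true, and_true]
      rw [← Equiv.sum_comp (Equiv.subRight k).symm m]
      rfl
    · intro m _
      rfl
  simp [h2]

/-! ### Words of signed letters -/

/-- The letters `±1, …, ±N`; the letter `⟨i, ε⟩` stands for `ε (i + 1)`. -/
@[ext]
structure SignedLetter (N : ℕ) where
  /-- the absolute value, minus one -/
  abs : Fin N
  /-- the sign -/
  sign : ℤˣ

namespace SignedLetter

variable {N : ℕ}

/-- A signed letter is a pair of an absolute value and a sign. -/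
def equivProd (N : ℕ) : Fin N × ℤˣ ≃ SignedLetter N where
  toFun a := ⟨a.1, a.2⟩
  invFun a := (a.abs, a.sign)

instance : Fintype (SignedLetter N) := Fintype.ofEquiv _ (equivProd N)

/-- The value of a signed letter. -/
def value (a : SignedLetter N) : ℤ := (a.sign : ℤ) * ((a.abs : ℕ) + 1 : ℕ)

theorem value_injective : Function.Injective (value : SignedLetter N → ℤ) := by
  rintro ⟨i, ε⟩ ⟨j, δ⟩ h
  simp only [value] at h
  rcases Int.units_eq_one_or ε with rfl | rfl <;> rcases Int.units_eq_one_or δ with rfl | rfl <;>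
    simp only [Units.val_one, Units.val_neg] at h
  · exact SignedLetter.ext (Fin.ext (by simp only; omega)) rfl
  · omega
  · omega
  · exact SignedLetter.ext (Fin.ext (by simp only; omega)) rfl

noncomputable instance : LinearOrder (SignedLetter N) := LinearOrder.lift' value value_injective

theorem lt_iff (a b : SignedLetter N) : a < b ↔ a.value < b.value := Iff.rfl

/-- Negative letters are odd. -/
def IsOdd (a : SignedLetter N) : Prop := a.sign = -1

instance : DecidablePred (IsOdd (N := N)) := fun a => inferInstanceAs (Decidable (a.sign = -1))

theorem sum_eq {M : Type*} [AddCommMonoid M] (f : SignedLetter N → M) :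
    ∑ a, f a = ∑ i, (f ⟨i, 1⟩ + f ⟨i, -1⟩) := by
  rw [← (equivProd N).sum_comp, Fintype.sum_prod_type]
  refine Finset.sum_congr rfl fun i _ => ?_
  rw [UnitsInt.univ]
  exact Finset.sum_pair (by decide)

theorem prod_eq {M : Type*} [CommMonoid M] (f : SignedLetter N → M) :
    ∏ a, f a = ∏ i, (f ⟨i, 1⟩ * f ⟨i, -1⟩) := sum_eq (M := Additive M) f

end SignedLetter

/-- The absolute values, minus one, of the letters of a word. -/
def absWord {N n : ℕ} (w : Fin n → SignedLetter N) (p : Fin n) : Fin N := (w p).abs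

/-- The number of negative letters. -/
def negCount {N n : ℕ} (w : Fin n → SignedLetter N) : ℕ := ∑ p, if (w p).sign = -1 then 1 else 0

theorem content_absWord {N n : ℕ} (w : Fin n → SignedLetter N) (i : Fin N) :
    content (absWord w) i = content w ⟨i, 1⟩ + content w ⟨i, -1⟩ := by
  change (∑ p, if (w p).abs = i then 1 else 0) = _
  rw [← sum_content_mul w fun a => if a.abs = i then 1 else 0, SignedLetter.sum_eq]
  simp [Finset.sum_add_distrib]

theorem negCount_eq {N n : ℕ} (w : Fin n → SignedLetter N) :
    negCount w = ∑ i, content w ⟨i, -1⟩ := by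
  rw [negCount, ← sum_content_mul w fun a => if a.sign = -1 then 1 else 0, SignedLetter.sum_eq]
  simp [show (1 : ℤˣ) ≠ -1 by decide]

/-- The content with `(P i).1` letters `i + 1` and `(P i).2` letters `-(i + 1)`. -/
def signedContent {N : ℕ} (P : Fin N → ℕ × ℕ) (a : SignedLetter N) : ℕ :=
  if a.sign = -1 then (P a.abs).2 else (P a.abs).1

theorem content_eq_signedContent_iff {N n : ℕ} (w : Fin n → SignedLetter N)
    (P : Fin N → ℕ × ℕ) :
    content w = signedContent P ↔ P = fun i => (content w ⟨i, 1⟩, content w ⟨i, -1⟩) := by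
  constructor
  · intro h
    ext i <;> simp [h, signedContent, show (1 : ℤˣ) ≠ -1 by decide]
  · rintro rfl
    ext ⟨i, ε⟩
    rcases Int.units_eq_one_or ε with rfl | rfl <;>
      simp [signedContent, show (1 : ℤˣ) ≠ -1 by decide]

/-- The generating function of signed words with a given number of letters of each absolute
value. -/
theorem sum_signedWords {𝕜 : Type*} [Field 𝕜] {q : 𝕜} {N n : ℕ}
    (stat : (Fin n → SignedLetter N) → ℕ)
    (hstat : ∀ c : SignedLetter N → ℕ, ∑ a, c a = n →
      (∑ w, if content w = c then q ^ stat w else 0) = contentWeight q SignedLetter.IsOdd c)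
    (m : Fin N → ℕ) (hm : ∑ i, m i = n) :
    (∑ w : Fin n → SignedLetter N, if content (absWord w) = m then
      Polynomial.C (q ^ stat w) * Polynomial.X ^ negCount w else 0) =
      Polynomial.C (qFactorial q n) * ∏ i, PowerSeries.coeff (m i) (superSeries q) := by
  classical
  -- `P` records how each `m i` splits into positive and negative letters.
  have hexp : Polynomial.C (qFactorial q n) * ∏ i, PowerSeries.coeff (m i) (superSeries q) =
      ∑ P ∈ Fintype.piFinset fun i => Finset.HasAntidiagonal.antidiagonal (m i),
        Polynomial.C (contentWeight q SignedLetter.IsOdd (signedContent P)) *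
          Polynomial.X ^ ∑ i, (P i).2 := by
    simp only [coeff_superSeries]
    rw [Finset.prod_univ_sum, Finset.mul_sum]
    refine Finset.sum_congr rfl fun P hP => ?_
    have hP' : ∑ a, signedContent P a = n := by
      rw [SignedLetter.sum_eq, ← hm]
      refine Finset.sum_congr rfl fun i _ => ?_
      have := Finset.HasAntidiagonal.mem_antidiagonal.1 (Fintype.mem_piFinset.1 hP i)
      simpa [signedContent, show (1 : ℤˣ) ≠ -1 by decide] using this
    rw [contentWeight, hP', SignedLetter.prod_eq, Finset.prod_mul_distrib,
      Finset.prod_pow_eq_pow_sum, ← mul_assoc, Polynomial.C_mul, map_prod]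
    have h : ∀ i, letterWeight q False (P i).1 * letterWeight q True (P i).2 =
        letterWeight q (SignedLetter.IsOdd ⟨i, 1⟩) (signedContent P ⟨i, 1⟩) *
        letterWeight q (SignedLetter.IsOdd ⟨i, -1⟩)
          (signedContent P ⟨i, -1⟩) := by
      intro i
      simp [letterWeight, signedContent, SignedLetter.IsOdd, show (1 : ℤˣ) ≠ -1 by decide]
    simp only [h]
  rw [hexp]
  have hterm : ∀ P ∈ Fintype.piFinset fun i => Finset.HasAntidiagonal.antidiagonal (m i),
      Polynomial.C (contentWeight q SignedLetter.IsOdd (signedContent P)) *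
          Polynomial.X ^ ∑ i, (P i).2 =
        ∑ w : Fin n → SignedLetter N, if content w = signedContent P then
          Polynomial.C (q ^ stat w) * Polynomial.X ^ negCount w else 0 := by
    intro P hP
    have hP' : ∑ a, signedContent P a = n := by
      rw [SignedLetter.sum_eq, ← hm]
      refine Finset.sum_congr rfl fun i _ => ?_
      have := Finset.HasAntidiagonal.mem_antidiagonal.1 (Fintype.mem_piFinset.1 hP i)
      simpa [signedContent, show (1 : ℤˣ) ≠ -1 by decide] using this
    rw [← hstat _ hP', map_sum, Finset.sum_mul]
    refine Finset.sum_congr rfl fun w _ => ?_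
    split_ifs with hw
    · rw [negCount_eq, (content_eq_signedContent_iff w P).1 hw]
    · simp
  -- A word determines its splitting `P`, so the inner sum over `P` has at most one nonzero term.
  rw [Finset.sum_congr rfl hterm, Finset.sum_comm]
  refine Finset.sum_congr rfl fun w _ => ?_
  simp only [content_eq_signedContent_iff]
  rw [Finset.sum_ite_eq']
  refine if_congr ?_ rfl rfl
  simp only [Fintype.mem_piFinset, Finset.HasAntidiagonal.mem_antidiagonal, ← content_absWord, funext_iff]

/-! ### Parking functions -/

theorem isParking_iff {n : ℕ} (a : Fin n → ℕ) :
    IsParking a ↔ (∀ p, 1 ≤ a p) ∧ ∀ j ≤ n, j ≤ ∑ p, if a p ≤ j then 1 else 0 := by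
  constructor
  · rintro ⟨τ, -, h⟩
    refine ⟨fun p => by simpa using (h (τ.symm p)).1, fun j hj => ?_⟩
    rw [← Equiv.sum_comp τ]
    calc j = ∑ p : Fin n, if (p : ℕ) < j then 1 else 0 := by
          rw [Finset.sum_boole, Fin.card_filter_val_lt, min_eq_right hj]; rfl
      _ ≤ _ := by
          refine Finset.sum_le_sum fun p _ => ?_
          have := (h p).2
          simp only [Function.comp_apply] at this
          split_ifs <;> omega
  · rintro ⟨h1, h2⟩
    have hmono := Tuple.monotone_sort a
    refine ⟨Tuple.sort a, hmono, fun i => ⟨h1 _, ?_⟩⟩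
    -- If the sorted word exceeds `i + 1` at index `i`, only the `i` smaller indices can carry
    -- values at most `i + 1`, one too few.
    by_contra! hlt
    have h3 := h2 (i + 1) i.isLt
    rw [← Equiv.sum_comp (Tuple.sort a)] at h3
    have h4 : (∑ p, if a (Tuple.sort a p) ≤ i + 1 then 1 else 0) ≤
        ∑ p : Fin n, if (p : ℕ) < i then 1 else 0 := by
      refine Finset.sum_le_sum fun p _ => ?_
      split_ifs with hp hp' <;> try omega
      have := hmono (show i ≤ p by rw [Fin.le_def]; omega)
      simp only [Function.comp_apply] at this hlt
      omega
    rw [← Finset.card_filter (fun p : Fin n => (p : ℕ) < i), Fin.card_filter_val_lt] at h4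
    omega

theorem isParking_succ_iff {n : ℕ} (b : Fin n → Fin (n + 1)) :
    IsParking (fun p => (b p : ℕ) + 1) ↔ IsParkingContent (content b) := by
  rw [isParking_iff, and_iff_right fun p => Nat.le_add_left 1 _]
  refine forall₂_congr fun j hj => ?_
  have : ∑ i ∈ Finset.range j, content b (Fin.ofNat (n + 1) i) =
      ∑ p, if (b p : ℕ) + 1 ≤ j then 1 else 0 := by
    simp only [content]
    rw [Finset.sum_comm]
    refine Finset.sum_congr rfl fun p _ => ?_
    have h : ∀ i ∈ Finset.range j, (if b p = Fin.ofNat (n + 1) i then 1 else 0) =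
        if (b p : ℕ) = i then 1 else 0 := by
      intro i hi
      -- Since `j ≤ n`, the indices below `j` do not wrap around.
      have : i % (n + 1) = i := Nat.mod_eq_of_lt (by have := Finset.mem_range.1 hi; omega)
      simp [Fin.ext_iff, this]
    rw [Finset.sum_congr rfl h, Finset.sum_ite_eq]
    exact if_congr Finset.mem_range rfl rfl
  rw [this]

/-! ### Signed parking functions as words of signed letters -/

namespace SignedParking

variable {n : ℕ}

noncomputable instance : Fintype (SignedParking n) := Fintype.ofFinite _

theorem one_le_word (w : SignedParking n) (p : Fin n) : 1 ≤ w.word p :=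
  ((isParking_iff _).1 w.isParking).1 p

theorem word_le (w : SignedParking n) (p : Fin n) : w.word p ≤ n := by
  have h := ((isParking_iff _).1 w.isParking).2 n le_rfl
  by_contra hlt
  have : (∑ p, if w.word p ≤ n then 1 else 0) < ∑ _p : Fin n, 1 :=
    Finset.sum_lt_sum (fun i _ => by split_ifs <;> simp) ⟨p, Finset.mem_univ _, by simp [hlt]⟩
  simp at this h
  omega

/-- The word of signed letters of a signed parking function. -/
def letters (w : SignedParking n) (p : Fin n) : SignedLetter (n + 1) :=
  -- Entries are at least 1, so the subtraction is exact. The alphabet has n+1 absolute values, one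
  -- more than parking functions use, to match the cycle lemma.
  ⟨⟨w.word p - 1, by have := w.word_le p; omega⟩, w.sign p⟩

theorem value_letters (w : SignedParking n) (p : Fin n) : (w.letters p).value = w.letter p := by
  simp only [SignedLetter.value, letters, letter, Nat.sub_add_cancel (w.one_le_word p)]

theorem outOfOrder_iff (w : SignedParking n) (i j : Fin n) :
    w.OutOfOrder i j ↔ SuperGT SignedLetter.IsOdd (w.letters i) (w.letters j) := by
  rw [OutOfOrder, SuperGT, SignedLetter.lt_iff, ← SignedLetter.value_injective.eq_iff,
    value_letters, value_letters]
  rfl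

theorem minusCount_eq (w : SignedParking n) : w.minusCount = negCount w.letters := by
  rw [minusCount, negCount, Nat.card_eq_fintype_card, Fintype.card_subtype, Finset.card_filter]
  rfl

theorem sinv_eq (w : SignedParking n) :
    w.sinv = inversions (SuperGT SignedLetter.IsOdd) w.letters := by
  classical
  rw [sinv, inversions, Nat.card_eq_fintype_card, Fintype.card_subtype, Finset.card_filter,
    Fintype.sum_prod_type]
  simp only [outOfOrder_iff]

theorem smaj_eq (w : SignedParking n) :
    w.smaj = majorIndex (SuperGT SignedLetter.IsOdd) w.letters := by
  classical
  rw [smaj, majorIndex, ← Fintype.sum_prod_type' (f := fun i j : Fin n =>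
    if (i : ℕ) + 1 = j ∧ SuperGT SignedLetter.IsOdd (w.letters i) (w.letters j) then (j : ℕ)
    else 0), ← Finset.sum_filter]
  symm
  refine Finset.sum_nbij (fun p => (p.2 : ℕ)) ?_ ?_ ?_ ?_
  · rintro ⟨i, j⟩ h
    simp only [Finset.mem_filter, Finset.mem_univ, true_and, Finset.mem_Icc] at h ⊢
    exact ⟨by omega, i, j, h.1, rfl, (w.outOfOrder_iff i j).2 h.2⟩
  · rintro ⟨i, j⟩ h ⟨i', j'⟩ h' e
    simp only [Finset.coe_filter, Finset.mem_univ, true_and, Set.mem_ofPred_eq] at h h' e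
    ext <;> simp <;> omega
  · intro d hd
    simp only [Finset.coe_filter, Set.mem_ofPred_eq] at hd
    obtain ⟨-, i, j, hi, hj, h⟩ := hd
    exact ⟨(i, j), by simpa [hi, hj] using (w.outOfOrder_iff i j).1 h, hj⟩
  · intro _ _
    rfl

theorem isNondecreasing_iff (w : SignedParking n) : w.IsNondecreasing ↔ w.sinv = 0 := by
  have hneg : ∀ i, w.sign i = -1 ↔ ¬ 0 < w.letter i := by
    intro i
    have h1 : (0 : ℤ) < w.word i := by exact_mod_cast w.one_le_word i
    rcases Int.units_eq_one_or (w.sign i) with h | h <;> rw [letter, h]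
    · simp [show (1 : ℤˣ) ≠ -1 by decide]
      have := w.one_le_word i
      omega
    · simp
  have h0 : w.sinv = 0 ↔ ∀ i j, i < j → ¬ w.OutOfOrder i j := by
    rw [sinv, Finite.card_eq_zero_iff, isEmpty_subtype]
    simp
  rw [h0, IsNondecreasing]
  constructor
  · rintro ⟨h1, h2⟩ i j hij (h | ⟨h, hs⟩)
    · exact (h1 hij.le).not_gt h
    · exact (hneg i).1 hs (h2 i j hij h)
  · intro h
    refine ⟨fun i j hij => ?_, fun i j hij he => ?_⟩
    · rcases hij.eq_or_lt with rfl | hij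
      · exact le_rfl
      · exact not_lt.1 fun hlt => h i j hij (Or.inl hlt)
    · by_contra hs
      exact h i j hij (Or.inr ⟨he, (hneg i).2 hs⟩)

-- Being a parking function depends only on the content of absolute values; the signs are free.
open Classical in
theorem sum_letters {M : Type*} [AddCommMonoid M] (f : (Fin n → SignedLetter (n + 1)) → M) :
    ∑ w : SignedParking n, f w.letters =
      ∑ v with IsParkingContent (content (absWord v)), f v := by
  have hword : ∀ w : SignedParking n, (fun p => (absWord w.letters p : ℕ) + 1) = w.word :=
    fun w => funext fun p => Nat.sub_add_cancel (w.one_le_word p)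
  refine Finset.sum_nbij letters ?_ ?_ ?_ fun _ _ => rfl
  · intro w _
    simp only [Finset.mem_filter, Finset.mem_univ, true_and]
    rw [← isParking_succ_iff, hword]
    exact w.isParking
  · intro w _ v _ h
    refine SignedParking.ext ?_ ?_
    · rw [← hword w, ← hword v, h]
    · exact funext fun p => congrArg SignedLetter.sign (congrFun h p)
  · intro v hv
    simp only [Finset.coe_filter, Finset.mem_univ, true_and, Set.mem_ofPred_eq] at hv
    exact ⟨⟨fun p => (absWord v p : ℕ) + 1, fun p => (v p).sign, (isParking_succ_iff _).2 hv⟩,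
      by simp, rfl⟩

/-- The argument common to both statistics: MacMahon's theorem is the only property of `stat`
required. -/
theorem sum_pow_stat (stat : (Fin n → SignedLetter (n + 1)) → ℕ)
    (hstat : ∀ c : SignedLetter (n + 1) → ℕ, ∑ a, c a = n →
      (∑ w, if content w = c then q ^ stat w else 0) = contentWeight q SignedLetter.IsOdd c) :
    ∑ w : SignedParking n, Polynomial.C (q ^ stat w.letters) * Polynomial.X ^ w.minusCount =
      superNarayana n := by
  classical
  simp only [minusCount_eq]
  rw [sum_letters fun v => Polynomial.C (q ^ stat v) * Polynomial.X ^ negCount v,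
    superNarayana_eq, sum_isParkingContent]
  · have hn : ((n : ℚ) + 1)⁻¹ * ((n + 1 : ℕ) : ℚ) = 1 := by
      push_cast
      exact inv_mul_cancel₀ (by positivity)
    -- The n+1 rotations cancel 1/(n+1); words are then grouped by their content of absolute values.
    rw [← Nat.cast_smul_eq_nsmul ℚ, smul_smul, hn, one_smul, Finset.mul_sum,
      ← Finset.sum_fiberwise_of_maps_to (g := fun v => content (absWord v))
        (t := {m ∈ Finset.piAntidiag (Finset.univ : Finset (Fin (n + 1))) n | IsParkingContent m})]
    · refine Finset.sum_congr rfl fun m hm => ?_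
      simp only [Finset.mem_filter, Finset.mem_piAntidiag] at hm
      rw [← sum_signedWords stat hstat m hm.1.1, ← Finset.sum_filter, Finset.filter_filter]
      refine Finset.sum_congr ?_ fun _ _ => rfl
      ext v
      simp only [Finset.mem_filter, Finset.mem_univ, true_and, and_iff_right_iff_imp]
      rintro rfl
      exact hm.2
    · intro v hv
      simp only [Finset.mem_filter, Finset.mem_univ, true_and] at hv
      simp [hv, sum_content]
  · intro m k
    exact Equiv.prod_comp (Equiv.addRight k) fun i => PowerSeries.coeff (m i) (superSeries q)

theorem map_sum_monomial (stat : SignedParking n → ℕ) :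
    (∑ w : SignedParking n, Polynomial.monomial w.minusCount
        (Polynomial.monomial (stat w) (1 : ℚ))).map (algebraMap ℚ[X] (RatFunc ℚ)) =
      ∑ w : SignedParking n, Polynomial.C (q ^ stat w) * Polynomial.X ^ w.minusCount := by
  rw [Polynomial.map_sum]
  refine Finset.sum_congr rfl fun w _ => ?_
  rw [Polynomial.map_monomial, ← Polynomial.C_mul_X_pow_eq_monomial,
    Polynomial.monomial_one_right_eq_X_pow, map_pow, RatFunc.algebraMap_X]

theorem coeff_sum_monomial (stat : SignedParking n → ℕ) (i j : ℕ) :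
    ((∑ w : SignedParking n, Polynomial.monomial w.minusCount
        (Polynomial.monomial (stat w) (1 : ℚ))).coeff i).coeff j =
      (Nat.card {w : SignedParking n // w.minusCount = i ∧ stat w = j} : ℚ) := by
  classical
  rw [Nat.card_eq_fintype_card, Fintype.card_subtype, Finset.card_filter, Polynomial.finsetSum_coeff,
    Polynomial.finsetSum_coeff]
  push_cast
  refine Finset.sum_congr rfl fun w _ => ?_
  rw [Polynomial.coeff_monomial, ite_and]
  split_ifs with h1 h2 <;> simp [Polynomial.coeff_monomial, *]

end SignedParking

end SuperNarayana

theorem mainTheorem3 (n : ℕ) :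
    ∃ P : Polynomial (Polynomial ℚ),
      P.map (algebraMap (Polynomial ℚ) (RatFunc ℚ)) = SuperNarayana.superNarayana n ∧
      (∀ i j : ℕ,
        (P.coeff i).coeff j =
          (Nat.card {w : SuperNarayana.SignedParking n // w.minusCount = i ∧ w.sinv = j} : ℚ)) ∧
      (∀ i j : ℕ,
        (P.coeff i).coeff j =
          (Nat.card {w : SuperNarayana.SignedParking n // w.minusCount = i ∧ w.smaj = j} : ℚ)) ∧
      (∀ k : ℕ,
        (P.map (Polynomial.evalRingHom (0 : ℚ))).coeff k =
          (Nat.card {w : SuperNarayana.SignedParking n //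
            w.minusCount = k ∧ w.IsNondecreasing} : ℚ)) := by
  open SuperNarayana SignedParking in
  have hinv := map_sum_monomial (n := n) sinv
  have hmaj := map_sum_monomial (n := n) smaj
  simp only [sinv_eq] at hinv
  simp only [smaj_eq] at hmaj
  rw [sum_pow_stat _ fun c hc => sum_pow_inversions one_sub_q_pow_ne_zero _ hc] at hinv
  rw [sum_pow_stat _ fun c hc => sum_pow_majorIndex one_sub_q_pow_ne_zero _ hc] at hmaj
  simp only [← sinv_eq] at hinv
  simp only [← smaj_eq] at hmaj
  -- Both polynomials over ℚ[q] have image `superNarayana n` over ℚ(q), hence coincide.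
  have heq := Polynomial.map_injective _ (IsFractionRing.injective (Polynomial ℚ) (RatFunc ℚ))
    (hinv.trans hmaj.symm)
  refine ⟨_, hinv, coeff_sum_monomial sinv, fun i j => ?_, fun k => ?_⟩
  · rw [heq, coeff_sum_monomial smaj]
  -- Setting q = 0 selects the signed parking functions without inversions.
  · rw [Polynomial.coeff_map, Polynomial.coe_evalRingHom, ← Polynomial.coeff_zero_eq_eval_zero,
      coeff_sum_monomial sinv]
    simp only [isNondecreasing_iff]
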